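/- **Conventions.** All groups are finite abelian, written additively. For $S\subseteq G$, $\mathrm{Cay}(G,S)$ is the digraph on $G$ with arcs $(g,g+s)$, and $\mathrm{Haar}(G,S)$ is the graph on $\mathbb Z_2\times G$ with edges $(0,g)(1,g+s)$, where $g\in G$, $s\in S$. Put $B_0=\{0\}\times G$. For $g\in G$ let $\bar g(0,x)=(0,x)$, $\bar g(1,x)=(1,x-g)$; let $\tau(i,x)=(i+1,x)$; for a bijection $\sigma:G\to E$ let $\hat\sigma(i,x)=(i,\sigma(x))$. Let $\mathrm{Iso}(G,E)=\{\tau^i\hat\alpha\bar g: i\in\mathbb Z_2,\ \alpha:G\to E \text{ a group isomorphism},\ g\in G\}$ and $\mathrm{Iso}(G)=\mathrm{Iso}(G,G)$. A bijection $s:\mathbb Z_2\times G\to\mathbb Z_2\times E$ is *normalised* if $s(0,0)\in B_0$ (that is, $s(0,0)\in\{0\}\times E$) implies $s(0,0)=(0,0)$. A *solving set for $\mathrm{Haar}(G,U)$ with respect to Haar graphs of $E$* is a set $M$ of normalised bijections $\mathbb Z_2\times G\to\mathbb Z_2\times E$ with $\mathrm{Iso}(G,E)\subseteq M$ such that for every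 $V\subseteq E$ with $\mathrm{Haar}(E,V)\cong\mathrm{Haar}(G,U)$ there is $s\in M$ with $s(\mathrm{Haar}(G,U))=\mathrm{Haar}(E,V)$. When $E=G$ it is called a *solving set for $\mathrm{Haar}(G,U)$*. A *solving set for $\mathrm{Cay}(G,S)$* is a set $M$ of permutations of $G$ fixing $0$, containing $\mathrm{Aut}(G)$, such that for every $T\subseteq G$ with $\mathrm{Cay}(G,T)\cong\mathrm{Cay}(G,S)$ there is $s\in M$ with $s(\mathrm{Cay}(G,S))=\mathrm{Cay}(G,T)$. For a set $\mathcal E$ of permutations of $\mathbb Z_2\times A$ let $[\mathcal E]$ be the set of normalised permutations of the form $\alpha\varphi$ with $\alpha\in\mathrm{Iso}(A)$, $\varphi\in\mathcal E$. A graph is *reducible* if it has two distinct vertices with the same neighbours. **Statement.** Let $A$ be an abelian group of odd order, $S\subseteq A$ with $S=-S$, and $\Gamma=\mathrm{Haar}(A,S)$. Then a solution to the isomorphism problem for $\Gamma$ is determined by a solution for a component of $\Gamma$, for a nontrivial block quotient of $\Gamma$, or for $\mathrm{Cay}(A,S)$, as follows. 0. If $S=\emptyset$, then $\mathrm{Iso}(A)$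 is a solving set for $\Gamma$. 1. *(Component.)* Suppose $S\neq\emptyset$ and $\Gamma$ is disconnected, and let $H=\langle S\rangle$. The component of $\Gamma$ containing $(0,0)$ has vertex set $\mathbb Z_2\times H$ and is $\mathrm{Haar}(H,S)$. For each $K\le A$ with $|K|=|H|$ let $M_K$ be any solving set for $\mathrm{Haar}(H,S)$ with respect to Haar graphs of $K$. Let $\mathcal E$ be the set of all permutations $\varphi$ of $\mathbb Z_2\times A$ for which there are such a $K$ and an $s\in M_K$ such that each coset of $H$ has a representative $a$, and there is $b\in A$, with: $s(i,h)=(j,k)$ implies $\varphi(i,a+h)=(j,b+k)$, for all $i\in\mathbb Z_2$, $h\in H$. Then $[\mathcal E]$ is a solving set for $\Gamma$. 2. *(Block quotient.)* Suppose $\Gamma$ is connected and reducible, and let $C=\{c\in A: c+S=S\}$. The sets $\{i\}\times(a+C)$ form a block system $\mathcal C$ of $\mathrm{Aut}(\Gamma)$ (which is transitive) with nontrivial blocks, and the block quotient graph $\Gamma/\mathcal C$ is $\mathrm{Haar}(A/C,S/C)$ under $\{i\}\times(a+C)\leftrightarrow(i,a+C)$, where $S/C=\{s+C:s\in S\}$.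 For each $C'\le A$ with $|C'|=|C|$ let $M_{C'}$ be any solving set for $\mathrm{Haar}(A/C,S/C)$ with respect to Haar graphs of $A/C'$. Let $\mathcal E$ be the set of all permutations $\varphi$ of $\mathbb Z_2\times A$ that extend some $s\in M_{C'}$ for some such $C'$; that is, $\varphi(i,x)=(j,y)$ implies $s(i,x+C)=(j,y+C')$. Then $[\mathcal E]$ is a solving set for $\Gamma$. 3. *(Cayley graph.)* Suppose $\Gamma$ is connected and not reducible. For every solving set $M$ for $\mathrm{Cay}(A,S)$, the set $[\{\hat s:s\in M\}]$ is a solving set for $\Gamma$. -/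

import Mathlib

open scoped Pointwise

namespace HaarIso

/-- `s` carries the relation `r` (adjacency of a graph or arcs of a digraph) on `V` exactly to the
relation `r'` on `W`; that is, `s(X) = X'` for the corresponding (di)graphs. -/
def Carries {V W : Type*} (s : V ≃ W) (r : V → V → Prop) (r' : W → W → Prop) : Prop :=
  ∀ u v : V, r u v ↔ r' (s u) (s v)

/-- The Haar graph `Haar(G, S)` of an abelian group: vertex set `ℤ₂ × G`, edges
`(0, g)(1, g + s)` with `g ∈ G`, `s ∈ S`. -/
def haar {G : Type*} [AddCommGroup G] (S : Set G) : SimpleGraph (ZMod 2 × G) where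
  Adj u v := (u.1 = 0 ∧ v.1 = 1 ∧ v.2 - u.2 ∈ S) ∨ (u.1 = 1 ∧ v.1 = 0 ∧ u.2 - v.2 ∈ S)
  symm := ⟨by
    rintro u v (⟨h, h', h''⟩ | ⟨h, h', h''⟩)
    · exact Or.inr ⟨h', h, h''⟩
    · exact Or.inl ⟨h', h, h''⟩⟩
  loopless := ⟨by
    rintro u (⟨h, h', -⟩ | ⟨h, h', -⟩)
    · exact zero_ne_one (h.symm.trans h')
    · exact zero_ne_one (h'.symm.trans h)⟩

/-- The Cayley digraph `Cay(G, S)` of an abelian group: arcs `(g, g + s)` with `s ∈ S`. -/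
def cay {G : Type*} [AddCommGroup G] (S : Set G) : Digraph G where
  Adj x y := y - x ∈ S

/-- The permutation `ḡ` of `ℤ₂ × G`: `(0, x) ↦ (0, x)` and `(1, x) ↦ (1, x - g)`. -/
def bar {G : Type*} [AddCommGroup G] (g : G) : Equiv.Perm (ZMod 2 × G) where
  toFun x := (x.1, if x.1 = 0 then x.2 else x.2 - g)
  invFun x := (x.1, if x.1 = 0 then x.2 else x.2 + g)
  left_inv x := by
    ext
    · rfl
    · by_cases h : x.1 = 0 <;> simp [h]
  right_inv x := by
    ext
    · rfl
    · by_cases h : x.1 = 0 <;> simp [h]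

/-- The map `(i, j) ↦ (i, σ j)` attached to a bijection `σ`. -/
def hat {G E : Type*} (σ : G ≃ E) : (ZMod 2 × G) ≃ (ZMod 2 × E) :=
  Equiv.prodCongr (Equiv.refl _) σ

/-- The permutation `τ ^ i` of `ℤ₂ × E`, where `τ (k, x) = (k + 1, x)`. -/
def tau {E : Type*} (i : ZMod 2) : Equiv.Perm (ZMod 2 × E) :=
  Equiv.prodCongr (Equiv.addRight i) (Equiv.refl _)

/-- The maps `τ ^ i ∘ α̂ ∘ ḡ : ℤ₂ × G → ℤ₂ × E` with `i ∈ ℤ₂`, `α : G → E` a group isomorphism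
and `g ∈ G`. For `E = G` this is the set `Iso(G)`. -/
def isoMaps (G E : Type*) [AddCommGroup G] [AddCommGroup E] :
    Set ((ZMod 2 × G) ≃ (ZMod 2 × E)) :=
  {f | ∃ (i : ZMod 2) (α : G ≃+ E) (g : G), f = ((bar g).trans (hat α.toEquiv)).trans (tau i)}

/-- If `s (0, 0)` lies in `{0} × E`, then `s (0, 0) = (0, 0)`. -/
def Normalised {G E : Type*} [AddCommGroup G] [AddCommGroup E]
    (s : (ZMod 2 × G) ≃ (ZMod 2 × E)) : Prop :=
  (s (0, 0)).1 = 0 → s (0, 0) = (0, 0)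

/-- `M` is a solving set for `Haar(G, U)` with respect to the Haar graphs of `E`.
For `E = G` this is the notion of a solving set for the Haar graph `Haar(G, U)`. -/
structure IsSolvingSet {G E : Type*} [AddCommGroup G] [AddCommGroup E] (U : Set G)
    (M : Set ((ZMod 2 × G) ≃ (ZMod 2 × E))) : Prop where
  solves : ∀ V : Set E, Nonempty (haar U ≃g haar V) →
    ∃ s ∈ M, Carries s (haar U).Adj (haar V).Adj
  normalised : ∀ s ∈ M, Normalised s
  iso_subset : isoMaps G E ⊆ M

/-- `M` is a solving set for the Cayley digraph `Cay(G, S)`. -/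
structure IsCayleySolvingSet {G : Type*} [AddCommGroup G] (S : Set G)
    (M : Set (Equiv.Perm G)) : Prop where
  solves : ∀ T : Set G, (∃ σ : Equiv.Perm G, Carries σ (cay S).Adj (cay T).Adj) →
    ∃ s ∈ M, Carries s (cay S).Adj (cay T).Adj
  fixes_zero : ∀ s ∈ M, s 0 = 0
  aut_subset : ∀ α : G ≃+ G, α.toEquiv ∈ M

/-- The normalised maps of the form `α ∘ φ` with `α ∈ Iso(A)` and `φ ∈ E`. -/
def isoClosure {A : Type*} [AddCommGroup A] (E : Set (Equiv.Perm (ZMod 2 × A))) :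
    Set (Equiv.Perm (ZMod 2 × A)) :=
  {ψ | Normalised ψ ∧ ∃ α ∈ isoMaps A A, ∃ φ ∈ E, ψ = φ.trans α}

/-- A graph is reducible if it has twins: distinct vertices with the same neighbours. -/
def IsReducible {V : Type*} (Γ : SimpleGraph V) : Prop :=
  ∃ u v : V, u ≠ v ∧ Γ.neighborSet u = Γ.neighborSet v

/-- The automorphism group of a graph, as a group of permutations of the vertices. -/
def autGroup {V : Type*} (Γ : SimpleGraph V) : Subgroup (Equiv.Perm V) where
  carrier := {σ | Carries σ Γ.Adj Γ.Adj}
  mul_mem' := fun {σ τ} hσ hτ u v => (hτ u v).trans (hσ (τ u) (τ v))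
  one_mem' := fun _ _ => Iff.rfl
  inv_mem' := fun {σ} hσ u v => by
    have h := hσ (σ⁻¹ u) (σ⁻¹ v)
    simpa using h.symm

/-- `𝒞` is a block system of the transitive permutation group `P`: the set of all conjugates of
a block of `P`. -/
def IsBlockSystem {V : Type*} (P : Subgroup (Equiv.Perm V)) (𝒞 : Set (Set V)) : Prop :=
  MulAction.IsPretransitive P V ∧
    ∃ B : Set V, B.Nonempty ∧ MulAction.IsBlock P B ∧ 𝒞 = Set.range fun g : P => g • B

/-- The block quotient graph `Γ/𝒞`. -/
def blockQuotient {V : Type*} (Γ : SimpleGraph V) (𝒞 : Set (Set V)) : SimpleGraph 𝒞 where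
  Adj B B' := B ≠ B' ∧ ∃ u ∈ B.1, ∃ v ∈ B'.1, Γ.Adj u v
  symm := ⟨fun _ _ ⟨h, u, hu, v, hv, huv⟩ => ⟨h.symm, v, hv, u, hu, huv.symm⟩⟩
  loopless := ⟨fun _ h => h.1 rfl⟩

/-- The sets `{i} × (a + C)`. -/
def cosetBlocks {A : Type*} [AddCommGroup A] (C : AddSubgroup A) : Set (Set (ZMod 2 × A)) :=
  {B | ∃ (i : ZMod 2) (a : A), B = {x | x.1 = i ∧ x.2 - a ∈ C}}

/-- The largest subgroup `C` of `A` such that `S` is a union of cosets of `C`,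
namely `{c | c + S = S}`. -/
def period {A : Type*} [AddCommGroup A] (S : Set A) : AddSubgroup A :=
  AddAction.stabilizer A S

/-- `φ` is an extension to `ℤ₂ × A` of the map `s : ℤ₂ × A/C → ℤ₂ × A/C'`: it maps each
`{i} × (a + C)` onto the image under `s` of `(i, a + C)`. -/
def ExtendsQuotient {A : Type*} [AddCommGroup A] {C C' : AddSubgroup A}
    (s : (ZMod 2 × (A ⧸ C)) ≃ (ZMod 2 × (A ⧸ C'))) (φ : Equiv.Perm (ZMod 2 × A)) : Prop :=
  ∀ x : ZMod 2 × A, ((φ x).1, ((φ x).2 : A ⧸ C')) = s (x.1, (x.2 : A ⧸ C))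

/-- `φ` acts as `s : ℤ₂ × H → ℤ₂ × K` on every coset: after the choice of a suitable
representative `a` of each coset of `H`, it maps `ℤ₂ × (a + H)` onto some `ℤ₂ × (b + K)`
by `s`, transported by translations by `a` and `b`. -/
def ActsOnCosetsAs {A : Type*} [AddCommGroup A] {H K : AddSubgroup A}
    (s : (ZMod 2 × H) ≃ (ZMod 2 × K)) (φ : Equiv.Perm (ZMod 2 × A)) : Prop :=
  ∀ x : A, ∃ a b : A, x - a ∈ H ∧
    ∀ (i : ZMod 2) (h : H), φ (i, a + h) = ((s (i, h)).1, b + ((s (i, h)).2 : A))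

end HaarIso

open HaarIso

/-!
The heart of the matter is the connected twin-free case. There, a side-preserving automorphism of
`Haar(A, S)` is a pair `(α, β)` of permutations of `A` with `y - x ∈ S ↔ β y - α x ∈ S`. It
preserves the number of common neighbours of two vertices `(0, x)`, `(0, y)`; as `S = -S`, the map
`z ↦ x + y - z` is an involution on these neighbours, whose only possible fixed point is the midpoint
of `x` and `y`. So the number is odd exactly when `y - x` is the double of an element of `S`
(`odd_card_common_iff`), and `α` is an automorphism of the Cayley graph of `2S`. By iteration it is
one of the Cayley graph of `2 ^ k S` for all `k ≥ 1`, and hence of `Cay(A, S)`, since some power of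
`2` is congruent to `1` modulo the odd number `|A|` (`cay_invariant`). Then `(1, α y)` and `(1, β y)`
are twins, so `α = β` (`eq_of_side_preserving`).

Now let `(α, β)` be a side-preserving isomorphism from `Haar(A, S)` to `Haar(A, V)`. Conjugating the
translations of the latter back to `Haar(A, S)` shows that `β ∘ α⁻¹` commutes with all translations,
so that `β = α + t` (`exists_eq_add_of_iso`). Hence `α` is an isomorphism from `Cay(A, S)` to
`Cay(A, V - t)`, and the solving set of the Cayley graph applies.

In the other cases, an isomorphism from `Haar(A, S)` to `Haar(A, V)` maps components to components
and twin classes to twin classes. After a translation which puts `0` into `V`, the components are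
the sets `ℤ₂ × (a + ⟨S⟩)` and `ℤ₂ × (a + ⟨V⟩)` (`reachable_iff`); the twin classes are the sets
`{i} × (a + C)` with `C` the period of the connection set (`neighborSet_eq_iff`). So the isomorphism
induces one between the components of `(0, 0)` or between the quotients modulo twins; the given
solving set replaces it by one of its members, which is then spread over all cosets (`cosetwise`) or
lifted to the twin classes (`blowup`). Representing the trivial coset by `0` keeps these extensions
normalised.
-/

namespace HaarIso

/-! ### Haar graphs and solving sets -/

section Basic

variable {G E : Type*} [AddCommGroup G] [AddCommGroup E]

@[simp]
theorem haar_adj_zero_one {S : Set G} {x y : G} : (haar S).Adj (0, x) (1, y) ↔ y - x ∈ S := by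
  simp [haar]

@[simp]
theorem haar_adj_one_zero {S : Set G} {x y : G} : (haar S).Adj (1, x) (0, y) ↔ x - y ∈ S := by
  simp [haar]

@[simp]
theorem not_haar_adj_same {S : Set G} {i : ZMod 2} {x y : G} : ¬ (haar S).Adj (i, x) (i, y) := by
  rintro (⟨h, h', -⟩ | ⟨h, h', -⟩)
  · exact zero_ne_one (h.symm.trans h')
  · exact zero_ne_one (h'.symm.trans h)

theorem zmod_two_cases (i : ZMod 2) : i = 0 ∨ i = 1 := by
  revert i
  decide

theorem haar_adj_add_left {S : Set G} (b : G) {i j : ZMod 2} {x y : G} :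
    (haar S).Adj (i, b + x) (j, b + y) ↔ (haar S).Adj (i, x) (j, y) := by
  obtain rfl | rfl := zmod_two_cases i <;> obtain rfl | rfl := zmod_two_cases j <;> simp

theorem haar_adj_coe {S : Set G} {H : AddSubgroup G} {i j : ZMod 2} {x y : H} :
    (haar (((↑) : H → G) ⁻¹' S)).Adj (i, x) (j, y) ↔ (haar S).Adj (i, (x : G)) (j, (y : G)) := by
  obtain rfl | rfl := zmod_two_cases i <;> obtain rfl | rfl := zmod_two_cases j <;> simp

theorem haar_adj_fst {S : Set G} {u v : ZMod 2 × G} (h : (haar S).Adj u v) :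
    v.1 = u.1 + 1 := by
  rcases h with ⟨h, h', -⟩ | ⟨h, h', -⟩ <;> rw [h, h'] <;> decide

theorem haar_adj_sub_mem {S : Set G} {H : AddSubgroup G} (hS : S ⊆ H) {u v : ZMod 2 × G}
    (h : (haar S).Adj u v) : v.2 - u.2 ∈ H := by
  rcases h with ⟨-, -, h⟩ | ⟨-, -, h⟩
  · exact hS h
  · rw [← neg_sub]
    exact H.neg_mem (hS h)

theorem nonempty_of_adj {S : Set G} {u v : ZMod 2 × G} (h : (haar S).Adj u v) : S.Nonempty := by
  rcases h with ⟨-, -, h⟩ | ⟨-, -, h⟩ <;> exact ⟨_, h⟩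

theorem nonempty_of_haar_iso {S : Set G} {V : Set E} (hS : S.Nonempty)
    (f : haar S ≃g haar V) : V.Nonempty := by
  obtain ⟨s, hs⟩ := hS
  have h : (haar S).Adj (0, 0) (1, s) := by simpa using hs
  exact nonempty_of_adj (f.map_rel_iff.2 h)

theorem nonempty_of_connected {S : Set G} (h : (haar S).Connected) : S.Nonempty := by
  have : Nontrivial (ZMod 2 × G) := ⟨(0, 0), (1, 0), by simp⟩
  obtain ⟨v, hv⟩ := h.preconnected.exists_adj_of_nontrivial (0, 0)
  exact nonempty_of_adj hv

theorem Carries.trans {U V W : Type*} {s : U ≃ V} {t : V ≃ W} {r r' r''}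
    (hs : Carries s r r') (ht : Carries t r' r'') : Carries (s.trans t) r r'' :=
  fun u v => (hs u v).trans (ht (s u) (s v))

theorem carries_iso {U V : Type*} {Γ : SimpleGraph U} {Δ : SimpleGraph V} (f : Γ ≃g Δ) :
    Carries f.toEquiv Γ.Adj Δ.Adj :=
  fun _ _ => f.map_rel_iff.symm

/-- `bar (-g)` translates the second side of a Haar graph by `g`, and so the connection set. -/
theorem carries_bar (V : Set G) (g : G) :
    Carries (bar (-g)) (haar {x | x + g ∈ V}).Adj (haar V).Adj := by
  rintro ⟨i, x⟩ ⟨j, y⟩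
  obtain rfl | rfl := zmod_two_cases i <;> obtain rfl | rfl := zmod_two_cases j <;>
    simp [bar, sub_add_eq_add_sub]

theorem carries_translate (V : Set G) (g : G) :
    Carries (Equiv.prodCongr (Equiv.refl (ZMod 2)) (Equiv.addLeft g)) (haar V).Adj (haar V).Adj := by
  rintro ⟨i, x⟩ ⟨j, y⟩
  exact (haar_adj_add_left g).symm

theorem carries_tau {S : Set G} (hS : S = -S) (i : ZMod 2) :
    Carries (tau i) (haar S).Adj (haar S).Adj := by
  have key : ∀ x y : G, x - y ∈ S ↔ y - x ∈ S := fun x y => by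
    conv_lhs => rw [hS, Set.mem_neg, neg_sub]
  have h2 : (1 + 1 : ZMod 2) = 0 := by decide
  rintro ⟨k, x⟩ ⟨j, y⟩
  obtain rfl | rfl := zmod_two_cases i <;> obtain rfl | rfl := zmod_two_cases k <;>
    obtain rfl | rfl := zmod_two_cases j <;> simp [tau, h2, key x y]

theorem carries_hat {S : Set G} {V : Set E} {σ : G ≃ E}
    (h : ∀ x y, y - x ∈ S ↔ σ y - σ x ∈ V) : Carries (hat σ) (haar S).Adj (haar V).Adj := by
  rintro ⟨i, x⟩ ⟨j, y⟩
  obtain rfl | rfl := zmod_two_cases i <;> obtain rfl | rfl := zmod_two_cases j <;>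
    simp [hat, h]

theorem bar_mem_isoMaps (g : G) : bar g ∈ isoMaps G G :=
  ⟨0, AddEquiv.refl G, g, by ext x <;> simp [hat, tau]⟩

theorem refl_mem_isoMaps : Equiv.refl (ZMod 2 × G) ∈ isoMaps G G :=
  ⟨0, AddEquiv.refl G, 0, by ext x <;> simp [hat, tau, bar]⟩

theorem normalised_of_mem_isoMaps {f : (ZMod 2 × G) ≃ (ZMod 2 × E)} (hf : f ∈ isoMaps G E) :
    Normalised f := by
  obtain ⟨i, α, g, rfl⟩ := hf
  intro h
  simpa [hat, tau, bar] using h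

/-- `isoClosure F` is a solving set as soon as `F` contains the identity and its normalised members
reach a translate of every connection set of a Haar graph isomorphic to `Haar(G, S)`. -/
theorem isSolvingSet_isoClosure {S : Set G} {F : Set (Equiv.Perm (ZMod 2 × G))}
    (hF : Equiv.refl _ ∈ F)
    (h : ∀ V : Set G, (haar S ≃g haar V) → ∃ g : G, ∃ φ ∈ F, Normalised φ ∧
      Carries φ (haar S).Adj (haar {x | x + g ∈ V}).Adj) :
    IsSolvingSet S (isoClosure F) where
  solves := by
    rintro V ⟨f⟩
    obtain ⟨g, φ, hφ, hn, hc⟩ := h V f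
    refine ⟨φ.trans (bar (-g)), ⟨fun h0 => ?_, _, bar_mem_isoMaps (-g), φ, hφ, rfl⟩,
      hc.trans (carries_bar V g)⟩
    have h1 : (φ (0, 0)).1 = 0 := h0
    have h2 := hn h1
    simp [h2, bar]
  normalised := fun _ hs => hs.1
  iso_subset := fun α hα => ⟨normalised_of_mem_isoMaps hα, α, hα, _, hF, rfl⟩

theorem isSolvingSet_empty : IsSolvingSet (∅ : Set G) (isoMaps G G) where
  solves := by
    rintro V ⟨f⟩
    have hV : V = ∅ := by
      by_contra hV
      exact (nonempty_of_haar_iso (Set.nonempty_iff_ne_empty.2 hV) f.symm).ne_empty rfl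
    subst hV
    exact ⟨_, refl_mem_isoMaps, fun _ _ => Iff.rfl⟩
  normalised := fun _ => normalised_of_mem_isoMaps
  iso_subset := subset_rfl

end Basic

/-! ### Coset decompositions -/

section Coset

variable {A : Type*} [AddCommGroup A]

open Classical in
/-- A section of `A → A ⧸ H` that chooses `0` in the trivial coset. -/
noncomputable def cosetRep (H : AddSubgroup A) : A ⧸ H → A :=
  fun q => if q = 0 then 0 else q.out

theorem cosetRep_zero (H : AddSubgroup A) : cosetRep H 0 = 0 := by
  simp [cosetRep]

@[simp]
theorem mk_cosetRep (H : AddSubgroup A) (q : A ⧸ H) : ((cosetRep H q : A) : A ⧸ H) = q := by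
  unfold cosetRep
  split_ifs with h
  · simp [h]
  · exact Quotient.out_eq' q

theorem sub_cosetRep_mem (H : AddSubgroup A) (a : A) : a - cosetRep H (a : A ⧸ H) ∈ H := by
  rw [← QuotientAddGroup.eq_zero_iff, QuotientAddGroup.mk_sub, mk_cosetRep, sub_self]

/-- The decomposition of `A` into cosets of `H`, with respect to the representatives `cosetRep`. -/
noncomputable def cosetEquiv (H : AddSubgroup A) : A ≃ (A ⧸ H) × H where
  toFun a := (a, ⟨a - cosetRep H (a : A ⧸ H), sub_cosetRep_mem H a⟩)
  invFun p := cosetRep H p.1 + p.2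
  left_inv a := by simp
  right_inv p := by
    have h : ((cosetRep H p.1 + (p.2 : A) : A) : A ⧸ H) = p.1 := by
      rw [QuotientAddGroup.mk_add, mk_cosetRep, (QuotientAddGroup.eq_zero_iff _).2 p.2.2, add_zero]
    ext1
    · exact h
    · ext
      simp [h]

theorem cosetEquiv_symm_apply (H : AddSubgroup A) (p : (A ⧸ H) × H) :
    (cosetEquiv H).symm p = cosetRep H p.1 + p.2 := rfl

@[simp]
theorem cosetEquiv_zero (H : AddSubgroup A) : cosetEquiv H 0 = (0, 0) := by
  ext <;> simp [cosetEquiv, cosetRep_zero]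

@[simp]
theorem cosetEquiv_symm_zero (H : AddSubgroup A) : (cosetEquiv H).symm (0, 0) = 0 := by
  rw [Equiv.symm_apply_eq, cosetEquiv_zero]

theorem cosetEquiv_fst (H : AddSubgroup A) (a : A) : (cosetEquiv H a).1 = a := rfl

theorem mk_cosetEquiv_symm (H : AddSubgroup A) (p : (A ⧸ H) × H) :
    ((cosetEquiv H).symm p : A ⧸ H) = p.1 := by
  rw [← cosetEquiv_fst, Equiv.apply_symm_apply]

theorem exists_equiv_map_zero {X Y : Type*} [Finite X] [Finite Y] [Zero X] [Zero Y]
    (h : Nat.card X = Nat.card Y) : ∃ e : X ≃ Y, e 0 = 0 := by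
  classical
  obtain ⟨e⟩ := (Finite.card_eq (α := X) (β := Y)).1 h
  exact ⟨e.trans (Equiv.swap (e 0) 0), by simp⟩

theorem card_quotient_eq_iff [Finite A] {H K : AddSubgroup A} :
    Nat.card (A ⧸ H) = Nat.card (A ⧸ K) ↔ Nat.card H = Nat.card K := by
  have hH := H.card_eq_card_quotient_mul_card_addSubgroup
  have hK := K.card_eq_card_quotient_mul_card_addSubgroup
  have h1 : 0 < Nat.card (A ⧸ K) := Nat.card_pos
  have h2 : 0 < Nat.card K := Nat.card_pos
  constructor <;> intro h <;> rw [h, hK] at hH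
  · exact (Nat.eq_of_mul_eq_mul_left h1 hH).symm
  · exact (Nat.eq_of_mul_eq_mul_right h2 hH).symm

theorem card_eq_of_prod_equiv {X Y : Type*} (e : (ZMod 2 × X) ≃ (ZMod 2 × Y)) :
    Nat.card X = Nat.card Y := by
  have h := Nat.card_congr e
  rw [Nat.card_prod, Nat.card_prod] at h
  exact Nat.eq_of_mul_eq_mul_left (by simp) h

end Coset

/-! ### Components -/

section Component

variable {A : Type*} [AddCommGroup A]

/-- If the two copies of each element lie in one component, then the components of `Haar(A, U)` are
the sets `ℤ₂ × (a + ⟨U⟩)`. -/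
theorem reachable_iff {U : Set A}
    (hU : ∀ (x : A) (i j : ZMod 2), (haar U).Reachable (i, x) (j, x)) (u v : ZMod 2 × A) :
    (haar U).Reachable u v ↔ v.2 - u.2 ∈ AddSubgroup.closure U := by
  constructor
  · rintro ⟨p⟩
    induction p with
    | nil => simp
    | cons h p ih =>
      have := (AddSubgroup.closure U).add_mem ih (haar_adj_sub_mem AddSubgroup.subset_closure h)
      simpa using this
  · intro h
    have key : ∀ d ∈ AddSubgroup.closure U, ∀ (x : A) (i j : ZMod 2),
        (haar U).Reachable (i, x) (j, x + d) := by
      intro d hd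
      induction hd using AddSubgroup.closure_induction with
      | mem d hd =>
        intro x i j
        have h1 : (haar U).Adj (0, x) (1, x + d) := by simpa using hd
        exact ((hU x i 0).trans h1.reachable).trans (hU _ 1 j)
      | zero => intro x i j; simpa using hU x i j
      | add a b _ _ ha hb =>
        intro x i j
        rw [← add_assoc]
        exact (ha x i i).trans (hb _ i j)
      | neg a _ ha =>
        intro x i j
        simpa using (ha (x + -a) j i).symm
    obtain ⟨i, x⟩ := u
    obtain ⟨j, y⟩ := v
    simpa using key _ h x i j

theorem reachable_vertical_of_zero_mem {U : Set A} (hU : 0 ∈ U) (x : A) (i j : ZMod 2) :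
    (haar U).Reachable (i, x) (j, x) := by
  obtain rfl | rfl := zmod_two_cases i <;> obtain rfl | rfl := zmod_two_cases j
  · rfl
  · exact SimpleGraph.Adj.reachable (by simpa using hU)
  · exact SimpleGraph.Adj.reachable (by simpa using hU)
  · rfl

/-- Walking `|A|` steps along the same element of `S` returns to the starting element of `A`, and
changes sides because `|A|` is odd. -/
theorem reachable_vertical_of_odd [Finite A] (hA : Odd (Nat.card A)) {S : Set A} (hS : S = -S)
    (hne : S.Nonempty) (x : A) (i j : ZMod 2) : (haar S).Reachable (i, x) (j, x) := by
  obtain ⟨s, hs⟩ := hne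
  have step : ∀ (i : ZMod 2) (x : A), (haar S).Adj (i, x) (i + 1, x + s) := by
    intro i x
    have h2 : (1 + 1 : ZMod 2) = 0 := by decide
    have hs' : -s ∈ S := by rwa [hS, Set.mem_neg, neg_neg]
    obtain rfl | rfl := zmod_two_cases i
    · simpa using hs
    · simpa [h2] using hs'
  have walk : ∀ (n : ℕ) (i : ZMod 2), (haar S).Reachable (i, x) (i + n, x + n • s) := by
    intro n i
    induction n with
    | zero => simp
    | succ n ih =>
      refine ih.trans ?_
      have := (step (i + n) (x + n • s)).reachable
      simpa [add_assoc, succ_nsmul] using this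
  have hflip : ∀ i : ZMod 2, (haar S).Reachable (i, x) (i + 1, x) := by
    intro i
    have h := walk (Nat.card A) i
    rwa [card_nsmul_eq_zero', add_zero, (ZMod.natCast_eq_one_iff_odd).2 hA] at h
  obtain rfl | rfl := zmod_two_cases i <;> obtain rfl | rfl := zmod_two_cases j
  · rfl
  · simpa using hflip 0
  · simpa using (hflip 0).symm
  · rfl

theorem exists_component_iso [Finite A] (hA : Odd (Nat.card A)) {S : Set A} (hS : S = -S)
    (hne : S.Nonempty) :
    ∃ e : haar (((↑) : AddSubgroup.closure S → A) ⁻¹' S) ≃g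
        (haar S).induce ((haar S).connectedComponentMk (0, 0)).supp,
      ∀ x, (e x : ZMod 2 × A) = (x.1, (x.2 : A)) := by
  have hmem : ∀ v : ZMod 2 × A, v ∈ ((haar S).connectedComponentMk (0, 0)).supp ↔
      v.2 ∈ AddSubgroup.closure S := by
    intro v
    rw [SimpleGraph.ConnectedComponent.mem_supp_iff, SimpleGraph.ConnectedComponent.eq,
      SimpleGraph.reachable_comm, reachable_iff (reachable_vertical_of_odd hA hS hne), sub_zero]
  refine ⟨⟨⟨fun x => ⟨(x.1, (x.2 : A)), (hmem _).2 x.2.2⟩,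
    fun v => (v.1.1, ⟨v.1.2, (hmem _).1 v.2⟩), fun _ => rfl, fun _ => rfl⟩, ?_⟩, fun _ => rfl⟩
  rintro ⟨i, x⟩ ⟨j, y⟩
  exact haar_adj_coe.symm

/-- An isomorphism between Haar graphs restricts, up to a translation of the codomain, to an
isomorphism between the components of `(0, 0)`. -/
theorem nonempty_component_iso {S V : Set A}
    (hS : ∀ (x : A) (i j : ZMod 2), (haar S).Reachable (i, x) (j, x))
    (hV : ∀ (x : A) (i j : ZMod 2), (haar V).Reachable (i, x) (j, x)) (f : haar S ≃g haar V) :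
    Nonempty (haar (((↑) : AddSubgroup.closure S → A) ⁻¹' S) ≃g
      haar (((↑) : AddSubgroup.closure V → A) ⁻¹' V)) := by
  set k : A := (f (0, 0)).2 with hk
  have hmem : ∀ u : ZMod 2 × A, u.2 ∈ AddSubgroup.closure S ↔
      (f u).2 - k ∈ AddSubgroup.closure V := by
    intro u
    rw [hk, ← reachable_iff hV, f.reachable_iff, reachable_iff hS, sub_zero]
  refine ⟨⟨⟨fun u => ((f (u.1, (u.2 : A))).1, ⟨(f (u.1, (u.2 : A))).2 - k, (hmem _).1 u.2.2⟩),
    fun w => ((f.symm (w.1, w.2 + k)).1, ⟨(f.symm (w.1, w.2 + k)).2, (hmem _).2 (by simp)⟩),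
    ?_, ?_⟩, ?_⟩⟩
  · rintro ⟨i, x⟩
    ext <;> simp
  · rintro ⟨i, x⟩
    ext <;> simp
  · rintro ⟨i, x⟩ ⟨j, y⟩
    rw [haar_adj_coe (x := x), ← f.map_rel_iff, Equiv.coe_fn_mk, haar_adj_coe, ← haar_adj_add_left k]
    simp

/-- The permutation of `ℤ₂ × A` which maps the cosets of `H` to those of `K` by `e` and acts as `s`
on each of them. -/
noncomputable def cosetwise {H K : AddSubgroup A} (e : A ⧸ H ≃ A ⧸ K)
    (s : (ZMod 2 × H) ≃ (ZMod 2 × K)) : Equiv.Perm (ZMod 2 × A) where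
  toFun u := ((s (u.1, (cosetEquiv H u.2).2)).1, (cosetEquiv K).symm
    (e (cosetEquiv H u.2).1, (s (u.1, (cosetEquiv H u.2).2)).2))
  invFun u := ((s.symm (u.1, (cosetEquiv K u.2).2)).1, (cosetEquiv H).symm
    (e.symm (cosetEquiv K u.2).1, (s.symm (u.1, (cosetEquiv K u.2).2)).2))
  left_inv u := by simp
  right_inv u := by simp

theorem cosetwise_apply {H K : AddSubgroup A} (e : A ⧸ H ≃ A ⧸ K)
    (s : (ZMod 2 × H) ≃ (ZMod 2 × K)) (i : ZMod 2) (q : A ⧸ H) (h : H) :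
    cosetwise e s (i, cosetRep H q + h) =
      ((s (i, h)).1, cosetRep K (e q) + ((s (i, h)).2 : A)) := by
  have : cosetRep H q + (h : A) = (cosetEquiv H).symm (q, h) := rfl
  rw [this]
  simp [cosetwise, cosetEquiv_symm_apply K]

theorem actsOnCosetsAs_cosetwise {H K : AddSubgroup A} (e : A ⧸ H ≃ A ⧸ K)
    (s : (ZMod 2 × H) ≃ (ZMod 2 × K)) : ActsOnCosetsAs s (cosetwise e s) :=
  fun x => ⟨cosetRep H x, cosetRep K (e x), sub_cosetRep_mem H x, fun i h => cosetwise_apply e s i x h⟩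

theorem cosetRep_add_sub_mem_iff (H : AddSubgroup A) (q q' : A ⧸ H) (h h' : H) :
    (cosetRep H q' + h') - (cosetRep H q + h) ∈ H ↔ q' = q := by
  rw [← QuotientAddGroup.eq_zero_iff]
  simp only [QuotientAddGroup.mk_sub, QuotientAddGroup.mk_add, mk_cosetRep,
    (QuotientAddGroup.eq_zero_iff _).2 (SetLike.coe_mem h),
    (QuotientAddGroup.eq_zero_iff _).2 (SetLike.coe_mem h'), add_zero, sub_eq_zero]

theorem carries_cosetwise {S V : Set A} {H K : AddSubgroup A} (hS : S ⊆ H) (hV : V ⊆ K)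
    (e : A ⧸ H ≃ A ⧸ K) {s : (ZMod 2 × H) ≃ (ZMod 2 × K)}
    (hs : Carries s (haar (((↑) : H → A) ⁻¹' S)).Adj (haar (((↑) : K → A) ⁻¹' V)).Adj) :
    Carries (cosetwise e s) (haar S).Adj (haar V).Adj := by
  rintro ⟨i, x⟩ ⟨j, y⟩
  obtain ⟨⟨q, h⟩, rfl⟩ := (cosetEquiv H).symm.surjective x
  obtain ⟨⟨q', h'⟩, rfl⟩ := (cosetEquiv H).symm.surjective y
  simp only [cosetEquiv_symm_apply, cosetwise_apply]
  by_cases hq : q' = q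
  · subst hq
    rw [haar_adj_add_left, haar_adj_add_left, ← haar_adj_coe, ← haar_adj_coe]
    exact hs _ _
  · refine iff_of_false (fun hadj => hq ?_) (fun hadj => hq ?_)
    · exact (cosetRep_add_sub_mem_iff H q q' h h').1 (haar_adj_sub_mem hS hadj)
    · exact e.injective ((cosetRep_add_sub_mem_iff K (e q) (e q') _ _).1 (haar_adj_sub_mem hV hadj))

theorem isSolvingSet_of_component [Finite A] (hA : Odd (Nat.card A)) {S : Set A} (hS : S = -S)
    (hne : S.Nonempty)
    (M : (K : AddSubgroup A) → Set ((ZMod 2 × AddSubgroup.closure S) ≃ (ZMod 2 × K)))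
    (hM : ∀ K : AddSubgroup A, Nat.card K = Nat.card (AddSubgroup.closure S) →
      IsSolvingSet (((↑) : AddSubgroup.closure S → A) ⁻¹' S) (M K)) :
    IsSolvingSet S (isoClosure {φ | ∃ K : AddSubgroup A,
      Nat.card K = Nat.card (AddSubgroup.closure S) ∧ ∃ s ∈ M K, ActsOnCosetsAs s φ}) := by
  refine isSolvingSet_isoClosure
    ⟨_, rfl, _, (hM _ rfl).iso_subset refl_mem_isoMaps, fun x => ⟨x, x, by simp, fun i h => rfl⟩⟩ ?_
  intro V f
  obtain ⟨v, hv⟩ := nonempty_of_haar_iso hne f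
  -- translating `V` by one of its elements puts `0` into the connection set
  set W : Set A := {x | x + v ∈ V} with hW
  have h0 : (0 : A) ∈ W := by simpa [hW] using hv
  let f' : haar S ≃g haar W :=
    f.trans (RelIso.symm ⟨bar (-v), fun {a b} => (carries_bar V v a b).symm⟩)
  obtain ⟨g⟩ := nonempty_component_iso (reachable_vertical_of_odd hA hS hne)
    (reachable_vertical_of_zero_mem h0) f'
  have hcard := card_eq_of_prod_equiv g.toEquiv
  obtain ⟨s, hsM, hs⟩ := (hM _ hcard.symm).solves _ ⟨g⟩
  obtain ⟨e, he⟩ := exists_equiv_map_zero (card_quotient_eq_iff.2 hcard)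
  refine ⟨v, cosetwise e s, ⟨_, hcard.symm, s, hsM, actsOnCosetsAs_cosetwise e s⟩, ?_,
    carries_cosetwise AddSubgroup.subset_closure AddSubgroup.subset_closure e hs⟩
  -- the trivial cosets are matched and represented by `0`, so `(0, 0)` is mapped as by `s`
  have h00 := cosetwise_apply e s 0 0 0
  simp only [cosetRep_zero, he, ZeroMemClass.coe_zero, add_zero, zero_add] at h00
  intro h
  rw [h00] at h ⊢
  rw [(hM _ hcard.symm).normalised s hsM h]
  simp

end Component

/-! ### Twins and block quotients -/

section Twins

variable {A : Type*} [AddCommGroup A]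

theorem mem_period_iff {U : Set A} {c : A} : c ∈ period U ↔ ∀ x, x + c ∈ U ↔ x ∈ U := by
  rw [period, AddAction.mem_stabilizer_iff, Set.ext_iff]
  constructor
  · intro h x
    rw [← h (x + c), Set.mem_vadd_set_iff_neg_vadd_mem]
    simp
  · intro h x
    rw [Set.mem_vadd_set_iff_neg_vadd_mem, ← h (-c +ᵥ x)]
    simp

/-- The twin classes of a Haar graph with edges are the sets `{i} × (a + C)`, where `C` is the
period of the connection set. -/
theorem neighborSet_eq_iff {U : Set A} (hU : U.Nonempty) {u v : ZMod 2 × A} :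
    (haar U).neighborSet u = (haar U).neighborSet v ↔ u.1 = v.1 ∧ u.2 - v.2 ∈ period U := by
  obtain ⟨s, hs⟩ := hU
  obtain ⟨i, x⟩ := u
  obtain ⟨j, y⟩ := v
  rw [Set.ext_iff]
  simp only [SimpleGraph.mem_neighborSet]
  constructor
  · intro h
    have hij : i = j := by
      obtain ⟨w, hw⟩ : ∃ w, (haar U).Adj (i, x) w := by
        obtain rfl | rfl := zmod_two_cases i
        · exact ⟨(1, x + s), by simpa using hs⟩
        · exact ⟨(0, x - s), by simpa using hs⟩
      have h1 := haar_adj_fst hw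
      rw [haar_adj_fst ((h w).1 hw)] at h1
      exact (add_right_cancel h1).symm
    subst hij
    refine ⟨rfl, mem_period_iff.2 fun z => ?_⟩
    obtain rfl | rfl := zmod_two_cases i
    · have := h (1, z + x)
      simpa [add_sub_assoc, eq_comm, iff_comm] using this
    · have := h (0, y - z)
      simp only [haar_adj_one_zero, sub_sub_cancel] at this
      rw [← this, sub_sub_eq_add_sub, add_comm x z, add_sub_assoc]
  · rintro ⟨hij, h⟩ ⟨k, z⟩
    have hij : i = j := hij
    subst hij
    have h : x - y ∈ period U := h
    rw [mem_period_iff] at h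
    obtain rfl | rfl := zmod_two_cases i <;> obtain rfl | rfl := zmod_two_cases k
    · simp
    · have := h (z - x)
      simp only [haar_adj_zero_one]
      rw [← this]
      simp
    · have := h (y - z)
      simp only [haar_adj_one_zero]
      rw [← this]
      simp
    · simp

theorem neighborSet_eq_iff_of_carries {U V : Type*} {Γ : SimpleGraph U} {Δ : SimpleGraph V}
    {f : U ≃ V} (hf : Carries f Γ.Adj Δ.Adj) {u v : U} :
    Γ.neighborSet u = Γ.neighborSet v ↔ Δ.neighborSet (f u) = Δ.neighborSet (f v) := by
  simp only [Set.ext_iff, SimpleGraph.mem_neighborSet]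
  rw [← f.forall_congr_right]
  exact forall_congr' fun w => by rw [hf u w, hf v w]

/-- The projection of vertices `ℤ₂ × A → ℤ₂ × A/C`. -/
def proj (C : AddSubgroup A) (u : ZMod 2 × A) : ZMod 2 × (A ⧸ C) := (u.1, u.2)

theorem proj_surjective (C : AddSubgroup A) : Function.Surjective (proj C) := by
  rintro ⟨i, q⟩
  obtain ⟨a, rfl⟩ := QuotientAddGroup.mk_surjective q
  exact ⟨(i, a), rfl⟩

theorem proj_eq_iff {C : AddSubgroup A} {u v : ZMod 2 × A} :
    proj C u = proj C v ↔ u.1 = v.1 ∧ u.2 - v.2 ∈ C := by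
  rw [proj, proj, Prod.mk.injEq, ← QuotientAddGroup.eq_zero_iff, QuotientAddGroup.mk_sub, sub_eq_zero]

theorem mk_mem_image_period_iff {U : Set A} {x : A} :
    (x : A ⧸ period U) ∈ ((↑) : A → A ⧸ period U) '' U ↔ x ∈ U := by
  refine ⟨?_, Set.mem_image_of_mem _⟩
  rintro ⟨y, hy, hxy⟩
  have h : x - y ∈ period U := by
    rw [← QuotientAddGroup.eq_zero_iff, QuotientAddGroup.mk_sub, hxy, sub_self]
  have := (mem_period_iff.1 h y).2 hy
  simpa using this

theorem haar_adj_proj {U : Set A} {u v : ZMod 2 × A} :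
    (haar (((↑) : A → A ⧸ period U) '' U)).Adj (proj (period U) u) (proj (period U) v) ↔
      (haar U).Adj u v := by
  obtain ⟨i, x⟩ := u
  obtain ⟨j, y⟩ := v
  simp only [haar, proj, ← QuotientAddGroup.mk_sub, mk_mem_image_period_iff]

/-- An isomorphism of Haar graphs induces one of their quotients modulo twins. -/
theorem exists_quotient_iso {S V : Set A} (hS : S.Nonempty) (f : haar S ≃g haar V) :
    Nonempty (haar (((↑) : A → A ⧸ period S) '' S) ≃g haar (((↑) : A → A ⧸ period V) '' V)) := by
  have hV := nonempty_of_haar_iso hS f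
  have key : ∀ u v, proj (period S) u = proj (period S) v ↔
      proj (period V) (f u) = proj (period V) (f v) := by
    intro u v
    rw [proj_eq_iff, proj_eq_iff, ← neighborSet_eq_iff hS, ← neighborSet_eq_iff hV]
    exact neighborSet_eq_iff_of_carries (carries_iso f)
  let r := Function.surjInv (proj_surjective (period S))
  have hr : ∀ q, proj (period S) (r q) = q := Function.surjInv_eq _
  refine ⟨⟨Equiv.ofBijective (fun q => proj (period V) (f (r q))) ⟨fun q q' h => ?_, fun w => ?_⟩,
    ?_⟩⟩
  · rw [← hr q, ← hr q']
    exact (key _ _).2 h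
  · obtain ⟨v, rfl⟩ := proj_surjective _ w
    refine ⟨proj (period S) (f.symm v), ?_⟩
    conv_rhs => rw [← f.apply_symm_apply v]
    exact (key _ _).1 (hr _)
  · intro q q'
    change (haar _).Adj (proj _ (f (r q))) (proj _ (f (r q'))) ↔ _
    rw [haar_adj_proj, f.map_rel_iff, ← haar_adj_proj, hr, hr]

/-- The extension of `s` to `ℤ₂ × A` which maps each coset of `C` to a coset of `C'` by `e`, after
translations by representatives. -/
noncomputable def blowup {C C' : AddSubgroup A} (e : C ≃ C')
    (s : (ZMod 2 × (A ⧸ C)) ≃ (ZMod 2 × (A ⧸ C'))) : Equiv.Perm (ZMod 2 × A) where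
  toFun u := ((s (u.1, (cosetEquiv C u.2).1)).1, (cosetEquiv C').symm
    ((s (u.1, (cosetEquiv C u.2).1)).2, e (cosetEquiv C u.2).2))
  invFun u := ((s.symm (u.1, (cosetEquiv C' u.2).1)).1, (cosetEquiv C).symm
    ((s.symm (u.1, (cosetEquiv C' u.2).1)).2, e.symm (cosetEquiv C' u.2).2))
  left_inv u := by simp
  right_inv u := by simp

theorem extendsQuotient_blowup {C C' : AddSubgroup A} (e : C ≃ C')
    (s : (ZMod 2 × (A ⧸ C)) ≃ (ZMod 2 × (A ⧸ C'))) : ExtendsQuotient s (blowup e s) := by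
  intro u
  simp [blowup, mk_cosetEquiv_symm, cosetEquiv_fst]

theorem isSolvingSet_of_quotient [Finite A] {S : Set A} (hne : S.Nonempty)
    (M : (C : AddSubgroup A) → Set ((ZMod 2 × (A ⧸ period S)) ≃ (ZMod 2 × (A ⧸ C))))
    (hM : ∀ C : AddSubgroup A, Nat.card C = Nat.card (period S) →
      IsSolvingSet (((↑) : A → A ⧸ period S) '' S) (M C)) :
    IsSolvingSet S (isoClosure {φ | ∃ C : AddSubgroup A,
      Nat.card C = Nat.card (period S) ∧ ∃ s ∈ M C, ExtendsQuotient s φ}) := by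
  refine isSolvingSet_isoClosure
    ⟨_, rfl, _, (hM _ rfl).iso_subset refl_mem_isoMaps, fun x => rfl⟩ ?_
  intro V f
  obtain ⟨g⟩ := exists_quotient_iso hne f
  have hcard := card_quotient_eq_iff.1 (card_eq_of_prod_equiv g.toEquiv)
  obtain ⟨s, hsM, hs⟩ := (hM _ hcard.symm).solves _ ⟨g⟩
  obtain ⟨e, he⟩ := exists_equiv_map_zero hcard
  refine ⟨0, blowup e s, ⟨_, hcard.symm, s, hsM, extendsQuotient_blowup e s⟩, ?_, ?_⟩
  · intro h
    have h1 : (s (0, 0)).1 = 0 := by simpa [blowup] using h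
    have h2 := (hM _ hcard.symm).normalised s hsM h1
    simp [blowup, h2, he]
  · have hV : {x | x + 0 ∈ V} = V := by simp
    rw [hV]
    intro u v
    rw [← haar_adj_proj, hs, ← haar_adj_proj (U := V)]
    exact iff_of_eq (congrArg₂ _ (extendsQuotient_blowup e s u).symm
      (extendsQuotient_blowup e s v).symm)

/-- Translations and `τ` already act transitively. -/
theorem haar_isPretransitive {S : Set A} (hS : S = -S) :
    MulAction.IsPretransitive (autGroup (haar S)) (ZMod 2 × A) := by
  refine ⟨fun u v => ⟨⟨(tau (v.1 - u.1)).trans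
    (Equiv.prodCongr (Equiv.refl (ZMod 2)) (Equiv.addLeft (v.2 - u.2))),
    (carries_tau hS _).trans (carries_translate S _)⟩, ?_⟩⟩
  change (u.1 + (v.1 - u.1), v.2 - u.2 + u.2) = v
  simp

theorem smul_twinClass {V : Type*} {Γ : SimpleGraph V} (g : autGroup Γ) (u : V) :
    g • {x | Γ.neighborSet x = Γ.neighborSet u} =
      {x | Γ.neighborSet x = Γ.neighborSet (g • u)} := by
  ext x
  rw [Set.mem_smul_set_iff_inv_smul_mem, Set.mem_ofPred_eq, Set.mem_ofPred_eq,
    neighborSet_eq_iff_of_carries (f := (g : Equiv.Perm V)) g.2]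
  have : (g : Equiv.Perm V) (g⁻¹ • x) = x := smul_inv_smul g x
  rw [this]
  rfl

theorem mem_cosetBlocks_iff {S : Set A} (hne : S.Nonempty) {B : Set (ZMod 2 × A)} :
    B ∈ cosetBlocks (period S) ↔
      ∃ u, B = {x | (haar S).neighborSet x = (haar S).neighborSet u} := by
  simp only [neighborSet_eq_iff hne, cosetBlocks, Set.mem_ofPred_eq, Prod.exists]

theorem isBlockSystem_cosetBlocks {S : Set A} (hS : S = -S) (hne : S.Nonempty) :
    IsBlockSystem (autGroup (haar S)) (cosetBlocks (period S)) := by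
  have htrans := haar_isPretransitive hS
  refine ⟨htrans, {x | (haar S).neighborSet x = (haar S).neighborSet (0, 0)}, ⟨(0, 0), rfl⟩, ?_, ?_⟩
  · intro g g' hgg'
    rw [smul_twinClass, smul_twinClass] at hgg' ⊢
    refine Set.disjoint_left.2 fun x hx hx' => hgg' ?_
    have hx : _ = _ := hx
    have hx' : _ = _ := hx'
    rw [← hx, hx']
  · ext B
    rw [mem_cosetBlocks_iff hne]
    simp only [smul_twinClass, Set.mem_range]
    constructor
    · rintro ⟨u, rfl⟩
      obtain ⟨g, rfl⟩ := MulAction.exists_smul_eq (autGroup (haar S)) ((0, 0) : ZMod 2 × A) u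
      exact ⟨g, rfl⟩
    · rintro ⟨g, rfl⟩
      exact ⟨_, rfl⟩

theorem not_isTrivialBlock_of_reducible {S : Set A} (hne : S.Nonempty)
    (hred : IsReducible (haar S)) {B : Set (ZMod 2 × A)} (hB : B ∈ cosetBlocks (period S)) :
    ¬ MulAction.IsTrivialBlock B := by
  obtain ⟨i, a, rfl⟩ := hB
  obtain ⟨u, v, huv, h⟩ := hred
  rw [neighborSet_eq_iff hne] at h
  rintro (hsub | huniv)
  · have h1 : ((i, a) : ZMod 2 × A) = (i, a + (u.2 - v.2)) := hsub (by simp) (by simpa using h.2)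
    simp only [Prod.mk.injEq, true_and, left_eq_add, sub_eq_zero] at h1
    exact huv (Prod.ext h.1 h1)
  · have h1 : ((i + 1, a) : ZMod 2 × A) ∈ {x : ZMod 2 × A | x.1 = i ∧ x.2 - a ∈ period S} := by
      rw [huniv]; trivial
    simpa using h1.1

theorem exists_blockQuotient_iso (S : Set A) :
    ∃ e : blockQuotient (haar S) (cosetBlocks (period S)) ≃g
        haar (((↑) : A → A ⧸ period S) '' S),
      ∀ B, ∀ x ∈ B.1, e B = (x.1, (x.2 : A ⧸ period S)) := by
  have hblock : ∀ B : cosetBlocks (period S), ∃ u, B.1 = {x | proj (period S) x = proj _ u} := by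
    rintro ⟨_, i, a, rfl⟩
    exact ⟨(i, a), by simp only [proj_eq_iff]⟩
  choose r hr using hblock
  have hmem : ∀ B, r B ∈ B.1 := fun B => by rw [hr]; rfl
  have hproj : ∀ B, ∀ x ∈ B.1, proj (period S) (r B) = proj _ x := by
    intro B x hx
    rw [hr] at hx
    exact hx.symm
  refine ⟨⟨Equiv.ofBijective (fun B => proj (period S) (r B)) ⟨fun B B' h => ?_, fun w => ?_⟩, ?_⟩,
    hproj⟩
  · have h : proj (period S) (r B) = proj (period S) (r B') := h
    rw [Subtype.ext_iff, hr B, hr B', h]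
  · obtain ⟨u, rfl⟩ := proj_surjective _ w
    exact ⟨⟨_, u.1, u.2, rfl⟩, hproj _ u ⟨rfl, by simp⟩⟩
  · intro B B'
    change (haar _).Adj (proj _ (r B)) (proj _ (r B')) ↔ _
    constructor
    · intro h
      rw [haar_adj_proj] at h
      refine ⟨?_, _, hmem B, _, hmem B', h⟩
      rintro rfl
      exact h.ne rfl
    · rintro ⟨-, u, hu, v, hv, huv⟩
      rwa [hproj B u hu, hproj B' v hv, haar_adj_proj]

end Twins

/-! ### Stability of twin-free Haar graphs of odd order -/

section Stability

variable {A : Type*} [AddCommGroup A]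

theorem add_self_injective (hA : Odd (Nat.card A)) {x y : A} (h : x + x = y + y) : x = y := by
  have h1 : 2 • (x - y) = 0 := by rw [two_nsmul, sub_add_sub_comm, h, sub_self]
  have h2 : addOrderOf (x - y) ∣ 2 := addOrderOf_dvd_of_nsmul_eq_zero h1
  have h3 : addOrderOf (x - y) ∣ Nat.card A := addOrderOf_dvd_natCard _
  have h4 : addOrderOf (x - y) ∣ 1 := by
    have := Nat.dvd_gcd h2 h3
    rwa [(Nat.coprime_two_left.2 hA : Nat.gcd 2 _ = 1)] at this
  rw [Nat.dvd_one, AddMonoid.addOrderOf_eq_one_iff, sub_eq_zero] at h4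
  exact h4

/-- An isomorphism from a connected Haar graph preserves both sides or exchanges them. -/
theorem fst_apply_of_connected {S V : Set A} (hconn : (haar S).Connected)
    (f : haar S ≃g haar V) (u : ZMod 2 × A) : (f u).1 = (f (0, 0)).1 + u.1 := by
  suffices h : ∀ w v, (haar S).Reachable w v → (f w).1 + v.1 = (f v).1 + w.1 by
    simpa using (h _ _ (hconn.preconnected u (0, 0)))
  rintro w v ⟨p⟩
  induction p with
  | nil => rfl
  | cons h p ih =>
    rw [haar_adj_fst h, haar_adj_fst (f.map_rel_iff.2 h), add_right_comm, ← add_assoc] at ih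
    exact add_right_cancel ih

/-- The permutation of `A` which a side-preserving permutation of `ℤ₂ × A` induces on side `i`. -/
def sidePerm (f : Equiv.Perm (ZMod 2 × A)) (hf : ∀ u, (f u).1 = u.1) (i : ZMod 2) :
    Equiv.Perm A where
  toFun x := (f (i, x)).2
  invFun x := (f.symm (i, x)).2
  left_inv x := by
    have h : (i, (f (i, x)).2) = f (i, x) := Prod.ext (hf (i, x)).symm rfl
    simp [h]
  right_inv x := by
    have h : (i, (f.symm (i, x)).2) = f.symm (i, x) :=
      Prod.ext (by simp [← hf (f.symm _)]) rfl
    simp [h]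

variable [Finite A]

/-- The number of common neighbours of `(0, x)` and `(0, y)` is odd exactly when `y - x` is the
double of an element of `S`: the involution `z ↦ x + y - z` of the common neighbours has at most one
fixed point, which is the midpoint of `x` and `y`. -/
theorem odd_card_common_iff (hA : Odd (Nat.card A)) {S : Set A} (hS : S = -S) (x y : A) :
    Odd (Nat.card {z : A // z - x ∈ S ∧ z - y ∈ S}) ↔ ∃ s ∈ S, s + s = y - x := by
  classical
  have := Fintype.ofFinite A
  have key : ∀ a b : A, a - b ∈ S ↔ b - a ∈ S := fun a b => by
    conv_lhs => rw [hS, Set.mem_neg, neg_sub]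
  let f : Function.End {z : A // z - x ∈ S ∧ z - y ∈ S} := fun z => ⟨x + y - z, by
    have h1 : x + y - z.1 - x = y - z.1 := by abel
    have h2 : x + y - z.1 - y = x - z.1 := by abel
    rw [h1, h2, key y, key x]
    exact z.2.symm⟩
  have hf : f ^ 2 ^ 1 = 1 := by
    rw [pow_one, pow_two]
    funext z
    exact Subtype.ext (sub_sub_cancel _ _)
  have hmod := Equiv.Perm.card_fixedPoints_modEq (p := 2) hf
  have hfix : ∀ z, z ∈ Function.fixedPoints f ↔ z.1 + z.1 = x + y := by
    intro z
    rw [Function.mem_fixedPoints, Function.IsFixedPt, Subtype.ext_iff]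
    change x + y - z.1 = z.1 ↔ _
    rw [sub_eq_iff_eq_add, eq_comm]
  have : Subsingleton (Function.fixedPoints f) := ⟨fun z w => Subtype.ext (Subtype.ext
    (add_self_injective hA (((hfix _).1 z.2).trans ((hfix _).1 w.2).symm)))⟩
  have hle : Fintype.card (Function.fixedPoints f) ≤ 1 := Fintype.card_le_one_iff_subsingleton.2 this
  have hex : (∃ s ∈ S, s + s = y - x) ↔ Nonempty (Function.fixedPoints f) := by
    constructor
    · rintro ⟨s, hs, hss⟩
      have hy : x + s - y = -s := by
        rw [← sub_eq_zero]
        have : x + s - y - -s = (s + s) - (y - x) := by abel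
        rw [this, hss, sub_self]
      refine ⟨⟨⟨x + s, by simpa using hs, ?_⟩, (hfix _).2 ?_⟩⟩
      · rw [hy, ← Set.mem_neg, ← hS]
        exact hs
      · have : x + s + (x + s) = x + x + (s + s) := by abel
        change x + s + (x + s) = x + y
        rw [this, hss]
        abel
    · rintro ⟨⟨z, hz⟩⟩
      refine ⟨z.1 - x, z.2.1, ?_⟩
      rw [sub_add_sub_comm, (hfix z).1 hz]
      abel
  rw [hex, ← Fintype.card_pos_iff, Nat.card_eq_fintype_card, Nat.odd_iff, hmod]
  omega

/-- A side-preserving automorphism of a Haar graph preserves the numbers of common neighbours, and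
therefore, on each side, the Cayley graph of the doubled connection set. -/
theorem double_invariant (hA : Odd (Nat.card A)) {S : Set A} (hS : S = -S)
    {α β : Equiv.Perm A} (h : ∀ x y, y - x ∈ S ↔ β y - α x ∈ S) (x y : A) :
    (∃ s ∈ S, s + s = y - x) ↔ ∃ s ∈ S, s + s = α y - α x := by
  have e : {z // z - x ∈ S ∧ z - y ∈ S} ≃ {z // z - α x ∈ S ∧ z - α y ∈ S} :=
    β.subtypeEquiv fun z => by rw [h x z, h y z]
  rw [← odd_card_common_iff hA hS, ← odd_card_common_iff hA hS, Nat.card_congr e]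

theorem pow_two_invariant (hA : Odd (Nat.card A)) {S : Set A} (hS : S = -S)
    {α β : Equiv.Perm A} (h : ∀ x y, y - x ∈ S ↔ β y - α x ∈ S) (k : ℕ) (x y : A) :
    y - x ∈ (2 ^ (k + 1) • · : A → A) '' S ↔ α y - α x ∈ (2 ^ (k + 1) • · : A → A) '' S := by
  induction k generalizing x y with
  | zero => simpa [two_nsmul] using double_invariant hA hS h x y
  | succ k ih =>
    -- `y - x ∈ 2 ^ (k + 1) • S` is preserved by `α`, so `double_invariant` applies to `(α, α)`
    have hneg : (2 ^ (k + 1) • · : A → A) '' S = -((2 ^ (k + 1) • · : A → A) '' S) := by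
      ext z
      constructor
      · rintro ⟨s, hs, rfl⟩
        rw [hS] at hs
        exact ⟨-s, hs, by simp⟩
      · rintro ⟨s, hs, hz⟩
        rw [hS] at hs
        exact ⟨-s, hs, by simp [hz]⟩
    have h2 := double_invariant hA hneg ih x y
    simpa only [Set.exists_mem_image, Set.mem_image, pow_succ _ (k + 1), mul_two, add_nsmul,
      exists_exists_and_eq_and] using h2

/-- A power of `2` is congruent to `1` modulo `|A|`, so that repeated doubling of `S` returns to
`S`. -/
theorem cay_invariant (hA : Odd (Nat.card A)) {S : Set A} (hS : S = -S)
    {α β : Equiv.Perm A} (h : ∀ x y, y - x ∈ S ↔ β y - α x ∈ S) (x y : A) :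
    y - x ∈ S ↔ α y - α x ∈ S := by
  have hpos : 0 < Nat.card A := Nat.card_pos
  obtain ⟨k, hk⟩ := Nat.exists_eq_succ_of_ne_zero (Nat.totient_pos.2 hpos).ne'
  have hmod := Nat.ModEq.pow_totient (Nat.coprime_two_left.2 hA)
  rw [hk, Nat.succ_eq_add_one] at hmod
  have hid : ∀ z : A, 2 ^ (k + 1) • z = z := by
    intro z
    have h1 := hmod.of_dvd (addOrderOf_dvd_natCard z)
    rw [← nsmul_eq_nsmul_iff_modEq, one_nsmul] at h1
    exact h1
  simpa [hid] using pow_two_invariant hA hS h k x y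

/-- Twin-free Haar graphs of odd order are stable: a side-preserving automorphism acts on both sides
by the same permutation. -/
theorem eq_of_side_preserving (hA : Odd (Nat.card A)) {S : Set A} (hS : S = -S)
    (hred : ¬ IsReducible (haar S)) {α β : Equiv.Perm A}
    (h : ∀ x y, y - x ∈ S ↔ β y - α x ∈ S) : α = β := by
  ext y
  by_contra hne
  refine hred ⟨(1, α y), (1, β y), by simpa using hne, ?_⟩
  ext ⟨i, z⟩
  obtain rfl | rfl := zmod_two_cases i
  · obtain ⟨x, rfl⟩ := α.surjective z
    simp only [SimpleGraph.mem_neighborSet, haar_adj_one_zero]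
    rw [← h, ← cay_invariant hA hS h]
  · simp

/-- Conjugating the translations of `Haar(A, V)` by an isomorphism gives side-preserving
automorphisms of `Haar(A, S)`; by stability, the actions of the isomorphism on the two sides differ
by a translation. -/
theorem exists_eq_add_of_iso (hA : Odd (Nat.card A)) {S V : Set A} (hS : S = -S)
    (hred : ¬ IsReducible (haar S)) {α β : Equiv.Perm A}
    (h : ∀ x y, y - x ∈ S ↔ β y - α x ∈ V) : ∃ t, ∀ x, β x = α x + t := by
  have hcomm : ∀ a : A, (α.trans (Equiv.addRight a)).trans α.symm =
      (β.trans (Equiv.addRight a)).trans β.symm := by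
    intro a
    refine eq_of_side_preserving hA hS hred fun x y => ?_
    simp [h]
  refine ⟨β (α.symm 0), fun x => ?_⟩
  have h1 := Equiv.congr_fun (hcomm (α x)) (α.symm 0)
  simp only [Equiv.trans_apply, Equiv.apply_symm_apply, Equiv.coe_addRight, zero_add,
    Equiv.symm_apply_apply] at h1
  rw [Equiv.eq_symm_apply] at h1
  rw [h1, add_comm]

theorem isSolvingSet_of_cay (hA : Odd (Nat.card A)) {S : Set A} (hS : S = -S)
    (hconn : (haar S).Connected) (hred : ¬ IsReducible (haar S)) {M : Set (Equiv.Perm A)}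
    (hM : IsCayleySolvingSet S M) : IsSolvingSet S (isoClosure (hat '' M)) := by
  refine isSolvingSet_isoClosure ⟨_, hM.aut_subset (AddEquiv.refl A), by ext <;> rfl⟩ ?_
  intro V f
  -- since `τ` is an automorphism of `Haar(A, S)`, the isomorphism may be taken side-preserving
  obtain ⟨f, hf⟩ : ∃ f : haar S ≃g haar V, ∀ u, (f u).1 = u.1 := by
    obtain h0 | h1 := zmod_two_cases (f (0, 0)).1
    · exact ⟨f, fun u => by rw [fst_apply_of_connected hconn, h0, zero_add]⟩
    · let τ : haar S ≃g haar S := ⟨tau 1, fun {a b} => (carries_tau hS 1 a b).symm⟩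
      refine ⟨τ.trans f, fun u => ?_⟩
      change (f (u.1 + 1, u.2)).1 = u.1
      have h2 : (1 + 1 : ZMod 2) = 0 := by decide
      rw [fst_apply_of_connected hconn, h1, add_left_comm, h2, add_zero]
  have hadj : ∀ x y, y - x ∈ S ↔ sidePerm f.toEquiv hf 1 y - sidePerm f.toEquiv hf 0 x ∈ V := by
    intro x y
    have h0 : f (0, x) = (0, (f (0, x)).2) := Prod.ext (hf _) rfl
    have h1 : f (1, y) = (1, (f (1, y)).2) := Prod.ext (hf _) rfl
    rw [← haar_adj_zero_one, ← f.map_rel_iff, h0, h1, haar_adj_zero_one]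
    rfl
  obtain ⟨t, ht⟩ := exists_eq_add_of_iso hA hS hred hadj
  obtain ⟨s, hsM, hs⟩ := hM.solves {x | x + t ∈ V} ⟨sidePerm f.toEquiv hf 0, fun x y => by
    simp only [cay, Set.mem_ofPred_eq]
    rw [hadj, ht, add_sub_right_comm]⟩
  refine ⟨t, hat s, ⟨s, hsM, rfl⟩, fun _ => ?_, carries_hat hs⟩
  simp [hat, hM.fixes_zero s hsM]

end Stability

end HaarIso

open HaarIso
theorem mainTheorem2 {A : Type*} [AddCommGroup A] [Finite A] (hA : Odd (Nat.card A))
    (S : Set A) (hS : S = -S) :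
    -- the degenerate edgeless case
    (S = ∅ → IsSolvingSet S (isoMaps A A)) ∧
    -- reduction to a component
    (S.Nonempty → ¬ (haar S).Connected →
      (∃ e : haar (((↑) : AddSubgroup.closure S → A) ⁻¹' S) ≃g
          (haar S).induce ((haar S).connectedComponentMk (0, 0)).supp,
        ∀ x, (e x : ZMod 2 × A) = (x.1, (x.2 : A))) ∧
      ∀ M : (K : AddSubgroup A) → Set ((ZMod 2 × AddSubgroup.closure S) ≃ (ZMod 2 × K)),
        (∀ K : AddSubgroup A, Nat.card K = Nat.card (AddSubgroup.closure S) →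
          IsSolvingSet (((↑) : AddSubgroup.closure S → A) ⁻¹' S) (M K)) →
        IsSolvingSet S (isoClosure {φ | ∃ K : AddSubgroup A,
          Nat.card K = Nat.card (AddSubgroup.closure S) ∧ ∃ s ∈ M K, ActsOnCosetsAs s φ})) ∧
    -- reduction to a nontrivial block quotient
    ((haar S).Connected → IsReducible (haar S) →
      (IsBlockSystem (autGroup (haar S)) (cosetBlocks (period S)) ∧
        (∀ B ∈ cosetBlocks (period S), ¬ MulAction.IsTrivialBlock B) ∧
        ∃ e : blockQuotient (haar S) (cosetBlocks (period S)) ≃g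
            haar (((↑) : A → A ⧸ period S) '' S),
          ∀ B, ∀ x ∈ B.1, e B = (x.1, (x.2 : A ⧸ period S))) ∧
      ∀ M : (C : AddSubgroup A) → Set ((ZMod 2 × (A ⧸ period S)) ≃ (ZMod 2 × (A ⧸ C))),
        (∀ C : AddSubgroup A, Nat.card C = Nat.card (period S) →
          IsSolvingSet (((↑) : A → A ⧸ period S) '' S) (M C)) →
        IsSolvingSet S (isoClosure {φ | ∃ C : AddSubgroup A,
          Nat.card C = Nat.card (period S) ∧ ∃ s ∈ M C, ExtendsQuotient s φ})) ∧
    -- reduction to the Cayley graph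
    ((haar S).Connected → ¬ IsReducible (haar S) →
      ∀ M : Set (Equiv.Perm A), IsCayleySolvingSet S M →
        IsSolvingSet S (isoClosure (hat '' M))) := by
  refine ⟨?_, fun hne _ => ⟨exists_component_iso hA hS hne, isSolvingSet_of_component hA hS hne⟩,
    fun hconn hred => ?_, fun hconn hred M hM => isSolvingSet_of_cay hA hS hconn hred hM⟩
  · rintro rfl
    exact isSolvingSet_empty
  · have hne := nonempty_of_connected hconn
    exact ⟨⟨isBlockSystem_cosetBlocks hS hne,
      fun B hB => not_isTrivialBlock_of_reducible hne hred hB, exists_blockQuotient_iso S⟩,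
      isSolvingSet_of_quotient hne⟩
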